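/- Let $\mathbb M_n$ denote the space of complex (or of real) $n\times n$ matrices; in the real case $A^*$ is the transpose, "Hermitian" means symmetric and "unitary" means orthogonal. For $A\in\mathbb M_n$ let $|A|=(A^*A)^{1/2}$ and let $|A|_{\mathrm{sym}}=\tfrac12\left(|A|+|A^*|\right)$. A matrix $S\in\mathbb M_n$ is called polar Hermitian if it has a polar decomposition $S=V|S|$, $V$ unitary, in which $V$ is a scalar multiple of a Hermitian unitary matrix. For positive semidefinite $A\in\mathbb M_n$ let $\lambda_1^{\downarrow}(A)\ge\dots\ge\lambda_n^{\downarrow}(A)$ be its eigenvalues, counted with multiplicity. For positive semidefinite $A,B\in\mathbb M_n$, the weak log-majorisation $A\prec_{\mathrm{wlog}}B$ means that $\prod_{j=1}^k\lambda_j^{\downarrow}(A)\le\prod_{j=1}^k\lambda_j^{\downarrow}(B)$ for all $k=1,\dots,n$. **Corollary.** Let $X_1,\dots,X_m\in\mathbb M_n$ be such that their sum $\sum_{k=1}^m X_k$ is polar Hermitian. Then $$\left|\sum_{k=1}^m X_k\right|_{\mathrm{sym}}\prec_{\mathrm{wlog}}\sum_{k=1}^m\left|X_k\right|_{\mathrm{sym}}.$$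 -/

import Mathlib

open scoped MatrixOrder ComplexOrder

namespace SymModulus

variable {ι 𝕜 : Type*} [Fintype ι] [DecidableEq ι] [RCLike 𝕜]

/-- The modulus `|A| = (A* A)^{1/2}` of a square matrix, the square root being the positive
semidefinite one (given by the continuous functional calculus). -/
noncomputable def modulus (A : Matrix ι ι 𝕜) : Matrix ι ι 𝕜 :=
  CFC.sqrt (A.conjTranspose * A)

/-- The symmetric modulus `|Z|_sym = (|Z| + |Z*|) / 2`. -/
noncomputable def symModulus (Z : Matrix ι ι 𝕜) : Matrix ι ι 𝕜 :=
  (2⁻¹ : 𝕜) • (modulus Z + modulus Z.conjTranspose)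

/-- `S` is polar Hermitian: it has a polar decomposition `S = V |S|`, with `V` unitary, in which
`V` is a scalar multiple of a Hermitian unitary matrix `W`. -/
def IsPolarHermitian (S : Matrix ι ι 𝕜) : Prop :=
  ∃ V ∈ Matrix.unitaryGroup ι 𝕜, S = V * modulus S ∧
    ∃ c : 𝕜, ∃ W ∈ Matrix.unitaryGroup ι 𝕜, W.IsHermitian ∧ V = c • W

/-- Weak log-majorisation `A ≺_wlog B` of positive semidefinite matrices: for every `k ≤ n`, the
product of the `k` largest eigenvalues of `A` (with multiplicities) is at most that of `B`.
`Matrix.IsHermitian.eigenvalues₀` lists the eigenvalues in decreasing order. The relation includes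
that both matrices are positive semidefinite. -/
def WeakLogMajorized (A B : Matrix ι ι 𝕜) : Prop :=
  ∃ (hA : A.PosSemidef) (hB : B.PosSemidef), ∀ k : ℕ, k ≤ Fintype.card ι →
    ∏ j : Fin (Fintype.card ι) with j.val < k, hA.isHermitian.eigenvalues₀ j ≤
      ∏ j : Fin (Fintype.card ι) with j.val < k, hB.isHermitian.eigenvalues₀ j

end SymModulus

open Matrix

namespace SymModulus

/-! ### Moduli and positive block matrices -/

section Modulus

variable {ι 𝕜 : Type*} [Fintype ι] [DecidableEq ι] [RCLike 𝕜]

/-! Write `S = ∑ X k`, `A = |S|_sym` and `B = ∑ |X k|_sym`. For every unit scalar `c`, the block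
matrix with diagonal `B, B` and off-diagonal `Re (c̄ S)` is positive semidefinite, being a sum of
such blocks for each `X k` (`posSemidef_fromBlocks_sum_symModulus`). If `S = c W |S|` with `W` a
Hermitian unitary, then `Re (c̄ S) = W A`. Compressing the block by `W U` and `U`, where `U` holds
the top `k` eigenvectors of `A`, leaves `D = Uᴴ A U` off the diagonal. A Schur complement then
bounds `det D ^ 2` by a product of two determinants of compressions of `B`, and Cauchy interlacing
bounds each of these by the product of the top `k` eigenvalues of `B`. -/

lemma modulus_posSemidef (A : Matrix ι ι 𝕜) : (modulus A).PosSemidef :=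
  (CFC.sqrt_nonneg _).posSemidef

lemma modulus_mul_self (A : Matrix ι ι 𝕜) : modulus A * modulus A = Aᴴ * A :=
  CFC.sqrt_mul_sqrt_self _ (posSemidef_conjTranspose_mul_self A).nonneg

lemma modulus_eq_of_mul_self {A P : Matrix ι ι 𝕜} (hP : P.PosSemidef) (h : P * P = Aᴴ * A) :
    modulus A = P :=
  CFC.sqrt_unique h hP.nonneg

lemma symModulus_posSemidef (A : Matrix ι ι 𝕜) : (symModulus A).PosSemidef :=
  ((modulus_posSemidef A).add (modulus_posSemidef Aᴴ)).smul (by positivity)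

lemma posSemidef_fromBlocks_zero {ι 𝕜 : Type*} [Fintype ι] [RCLike 𝕜]
    {P Q : Matrix ι ι 𝕜} (hP : P.PosSemidef) (hQ : Q.PosSemidef) :
    (fromBlocks P 0 0 Q).PosSemidef := by
  refine .of_dotProduct_mulVec_nonneg ?_ fun x => ?_
  · rw [isHermitian_fromBlocks_iff]
    exact ⟨hP.isHermitian, by simp, by simp, hQ.isHermitian⟩
  · have h1 := hP.dotProduct_mulVec_nonneg (x ∘ Sum.inl)
    have h2 := hQ.dotProduct_mulVec_nonneg (x ∘ Sum.inr)
    simpa [fromBlocks_mulVec, dotProduct, Fintype.sum_sum_type] using add_nonneg h1 h2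

/-- The Hermitian matrix `M = [0, X; Xᴴ, 0]` has modulus `diag (|Xᴴ|, |X|)`, and `|M| + M` is twice
the positive part of `M`. -/
lemma posSemidef_fromBlocks_modulus (X : Matrix ι ι 𝕜) :
    (fromBlocks (modulus Xᴴ) X Xᴴ (modulus X)).PosSemidef := by
  set M : Matrix (ι ⊕ ι) (ι ⊕ ι) 𝕜 := fromBlocks 0 X Xᴴ 0 with hM
  have hMh : Mᴴ = M := by simp [hM, fromBlocks_conjTranspose]
  have habs : CFC.abs M = fromBlocks (modulus Xᴴ) 0 0 (modulus X) := by
    refine modulus_eq_of_mul_self (A := M)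
      (posSemidef_fromBlocks_zero (modulus_posSemidef _) (modulus_posSemidef _)) ?_
    rw [hMh]
    simp [hM, fromBlocks_multiply, modulus_mul_self]
  have h : 0 ≤ CFC.abs M + M := by
    rw [CFC.abs_add_self M hMh, two_smul]
    exact add_nonneg (CFC.posPart_nonneg M) (CFC.posPart_nonneg M)
  rw [habs, hM, fromBlocks_add] at h
  simpa using h.posSemidef

/-- The Hermitian part of `c̄ X`. -/
noncomputable def rotatedRealPart {ι 𝕜 : Type*} [RCLike 𝕜] (c : 𝕜) (X : Matrix ι ι 𝕜) : Matrix ι ι 𝕜 :=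
  (2⁻¹ : 𝕜) • (star c • X + c • Xᴴ)

lemma rotatedRealPart_sum {ι 𝕜 κ : Type*} [RCLike 𝕜] (s : Finset κ) (c : 𝕜)
    (X : κ → Matrix ι ι 𝕜) :
    rotatedRealPart c (∑ k ∈ s, X k) = ∑ k ∈ s, rotatedRealPart c (X k) := by
  simp [rotatedRealPart, Finset.smul_sum, Finset.sum_add_distrib, conjTranspose_sum]

/-- Congruence by `diag (c̄, 1)` rotates the off-diagonal blocks to `c̄ X` and `c Xᴴ`; averaging
with the block-swapped matrix symmetrises everything. -/
lemma posSemidef_fromBlocks_symModulus {c : 𝕜} (hc : star c * c = 1) (X : Matrix ι ι 𝕜) :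
    (fromBlocks (symModulus X) (rotatedRealPart c X) (rotatedRealPart c X)
      (symModulus X)).PosSemidef := by
  have hc' : c * star c = 1 := by rw [mul_comm, hc]
  have h1 := (posSemidef_fromBlocks_modulus X).mul_mul_conjTranspose_same
    (fromBlocks (star c • (1 : Matrix ι ι 𝕜)) 0 0 (1 : Matrix ι ι 𝕜))
  have h2 := h1.submatrix (Sum.swap : ι ⊕ ι → ι ⊕ ι)
  have h := (h1.add h2).smul (show (0 : 𝕜) ≤ 2⁻¹ by positivity)
  convert h using 1
  rw [fromBlocks_conjTranspose]
  simp only [fromBlocks_multiply, conjTranspose_smul, conjTranspose_one, conjTranspose_zero,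
    Matrix.mul_zero, Matrix.zero_mul, add_zero, zero_add, Matrix.smul_mul, Matrix.mul_smul,
    Matrix.one_mul, Matrix.mul_one, fromBlocks_submatrix_sum_swap_sum_swap, fromBlocks_add,
    fromBlocks_smul, star_star, smul_smul, hc', one_smul, symModulus, rotatedRealPart]
  congr 2 <;> exact add_comm _ _

lemma posSemidef_fromBlocks_sum_symModulus {κ : Type*} (s : Finset κ) {c : 𝕜}
    (hc : star c * c = 1) (X : κ → Matrix ι ι 𝕜) :
    (fromBlocks (∑ k ∈ s, symModulus (X k)) (rotatedRealPart c (∑ k ∈ s, X k))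
      (rotatedRealPart c (∑ k ∈ s, X k)) (∑ k ∈ s, symModulus (X k))).PosSemidef := by
  convert posSemidef_sum s fun k _ => posSemidef_fromBlocks_symModulus hc (X k)
  rw [rotatedRealPart_sum]
  ext (i | i) (j | j) <;> simp [Matrix.sum_apply]

/-- In a polar decomposition `S = c W |S|` with `W` a Hermitian unitary, the Hermitian part of
`c̄ S` is `W |S|_sym`. -/
lemma rotatedRealPart_eq_mul_symModulus {c : 𝕜} (hc : star c * c = 1) {S W : Matrix ι ι 𝕜}
    (hW : W * W = 1) (hWh : Wᴴ = W) (hS : S = (c • W) * modulus S) :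
    rotatedRealPart c S = W * symModulus S := by
  have hc' : c * star c = 1 := by rw [mul_comm, hc]
  have hP := modulus_posSemidef S
  set P := modulus S with hPdef
  have hSh : Sᴴ = star c • (P * W) := by
    rw [hS, conjTranspose_mul, conjTranspose_smul, hWh, hP.isHermitian.eq, Matrix.mul_smul]
  have hadj : modulus Sᴴ = W * P * W := by
    refine modulus_eq_of_mul_self ?_ ?_
    · simpa [hWh] using hP.mul_mul_conjTranspose_same W
    · rw [conjTranspose_conjTranspose, hSh]
      conv_rhs => rw [hS]
      simp only [Matrix.smul_mul, Matrix.mul_smul, smul_smul, hc, one_smul, ← Matrix.mul_assoc]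
      rw [Matrix.mul_assoc (W * P) W W, hW, Matrix.mul_one]
  have hcS : star c • S = W * P := by
    conv_lhs => rw [hS]
    rw [Matrix.smul_mul, smul_smul, hc, one_smul]
  rw [rotatedRealPart, symModulus, hadj, hcS, hSh, smul_smul, hc', one_smul, Matrix.mul_smul,
    Matrix.mul_add, ← hPdef, ← Matrix.mul_assoc, ← Matrix.mul_assoc, hW, Matrix.one_mul]

lemma IsPolarHermitian.exists_unit {S : Matrix ι ι 𝕜} (hS : IsPolarHermitian S) :
    ∃ c : 𝕜, star c * c = 1 ∧ ∃ W : Matrix ι ι 𝕜, W * W = 1 ∧ Wᴴ = W ∧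
      S = (c • W) * modulus S := by
  obtain ⟨V, hV, hSV, c, W, hW, hWh, rfl⟩ := hS
  have hWW : W * W = 1 := by
    have := mem_unitaryGroup_iff.1 hW
    rwa [star_eq_conjTranspose, hWh.eq] at this
  -- Over an empty index type unitarity of `c W` says nothing about `c`, so `1` replaces it.
  rcases isEmpty_or_nonempty ι with hι | ⟨⟨i⟩⟩
  · exact ⟨1, by simp, W, hWW, hWh.eq, Subsingleton.elim _ _⟩
  · refine ⟨c, ?_, W, hWW, hWh.eq, hSV⟩
    have h := mem_unitaryGroup_iff'.1 hV
    rw [star_eq_conjTranspose, conjTranspose_smul, hWh.eq, Matrix.smul_mul, Matrix.mul_smul, hWW,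
      smul_smul] at h
    simpa using congrFun (congrFun h i) i

end Modulus

/-! ### Ordered eigenvalues and interlacing -/

section Eigenvalues

variable {ι 𝕜 : Type*} [Fintype ι] [DecidableEq ι] [RCLike 𝕜]

/-- Spectral theorem with the eigenvalues in decreasing order. -/
lemma exists_diagonal_eigenvalues₀ {A : Matrix ι ι 𝕜} (hA : A.IsHermitian) :
    ∃ V : Matrix ι (Fin (Fintype.card ι)) 𝕜, Vᴴ * V = 1 ∧ V * Vᴴ = 1 ∧
      A = V * diagonal (fun j => (hA.eigenvalues₀ j : 𝕜)) * Vᴴ := by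
  let e : Fin (Fintype.card ι) ≃ ι := Fintype.equivOfCardEq (Fintype.card_fin _)
  let U : Matrix ι ι 𝕜 := hA.eigenvectorUnitary
  have hU : Uᴴ * U = 1 := mem_unitaryGroup_iff'.1 hA.eigenvectorUnitary.2
  have hU' : U * Uᴴ = 1 := mem_unitaryGroup_iff.1 hA.eigenvectorUnitary.2
  refine ⟨U.submatrix id e, ?_, ?_, ?_⟩
  · rw [conjTranspose_submatrix, submatrix_mul _ _ _ _ _ Function.bijective_id |>.symm, hU]
    simp
  · rw [conjTranspose_submatrix, submatrix_mul_equiv, hU']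
    simp
  · have hd : diagonal (fun j => (hA.eigenvalues₀ j : 𝕜)) =
        (diagonal (RCLike.ofReal ∘ hA.eigenvalues) : Matrix ι ι 𝕜).submatrix e e := by
      rw [submatrix_diagonal_equiv]
      congr 1
      ext j
      simp [IsHermitian.eigenvalues, e]
    rw [hd, conjTranspose_submatrix, submatrix_mul_equiv, submatrix_mul_equiv, submatrix_id_id]
    exact hA.spectral_theorem

lemma star_dotProduct_diagonal_mulVec {κ : Type*} [Fintype κ] [DecidableEq κ] (d : κ → ℝ)
    (z : κ → 𝕜) :
    star z ⬝ᵥ (diagonal (fun j => (d j : 𝕜)) *ᵥ z) = ((∑ j, d j * ‖z j‖ ^ 2 : ℝ) : 𝕜) := by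
  simp only [dotProduct, mulVec_diagonal, Pi.star_apply, RCLike.star_def]
  push_cast
  refine Finset.sum_congr rfl fun j _ => ?_
  rw [← RCLike.conj_mul]
  ring

/-- Cauchy interlacing (Courant–Fischer) for diagonal matrices. -/
lemma le_of_diagonal_le_compression {p n : ℕ} {d : Fin p → ℝ} {e : Fin n → ℝ}
    (hd : Antitone d) (he : Antitone e) {M : Matrix (Fin n) (Fin p) 𝕜} (hM : Mᴴ * M = 1)
    (h : (Mᴴ * diagonal (fun j => (e j : 𝕜)) * M - diagonal (fun j => (d j : 𝕜))).PosSemidef)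
    (j : Fin p) (hj : j.val < n) : d j ≤ e ⟨j, hj⟩ := by
  let E : (Fin (j + 1) → 𝕜) →ₗ[𝕜] (Fin p → 𝕜) :=
    Function.ExtendByZero.linearMap 𝕜 (Fin.castLE j.2)
  let R : (Fin n → 𝕜) →ₗ[𝕜] (Fin j → 𝕜) := LinearMap.funLeft 𝕜 𝕜 (Fin.castLE hj.le)
  have hinj : Function.Injective (Fin.castLE j.2 : Fin (j + 1) → Fin p) := Fin.castLE_injective _
  -- Dimension count: `j + 1` free coordinates against `j` linear conditions.
  have hker : LinearMap.ker (R ∘ₗ M.mulVecLin ∘ₗ E) ≠ ⊥ :=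
    LinearMap.ker_ne_bot_of_finrank_lt (by simp)
  obtain ⟨a, ha, ha0⟩ := (Submodule.ne_bot_iff _).1 hker
  set z : Fin p → 𝕜 := E a with hz
  have hzero : ∀ i : Fin n, i.val < j.val → (M *ᵥ z) i = 0 := fun i hi =>
    congrFun (LinearMap.mem_ker.1 ha) ⟨i, hi⟩
  have hzj : ∀ l : Fin p, j < l → z l = 0 := by
    intro l hl
    refine Function.extend_apply' _ _ _ ?_
    rintro ⟨b, rfl⟩
    have := b.2
    have hl' : j.val < b.val := hl
    omega
  have hz0 : z ≠ 0 := by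
    intro h0
    apply ha0
    ext b
    have : z (Fin.castLE j.2 b) = a b := hinj.extend_apply _ _ _
    rw [← this, h0]; rfl
  have hnorm : ∑ i, ‖(M *ᵥ z) i‖ ^ 2 = ∑ l, ‖z l‖ ^ 2 := by
    have h1 : star (M *ᵥ z) ⬝ᵥ (M *ᵥ z) = star z ⬝ᵥ z := by
      rw [star_mulVec, ← dotProduct_mulVec, mulVec_mulVec, hM, one_mulVec]
    have h2 := star_dotProduct_diagonal_mulVec (fun _ => 1) (M *ᵥ z)
    have h3 := star_dotProduct_diagonal_mulVec (fun _ => 1) z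
    simp only [RCLike.ofReal_one, diagonal_one, one_mulVec, one_mul] at h2 h3
    rw [h2, h3] at h1
    exact_mod_cast h1
  have hpos : 0 < ∑ l, ‖z l‖ ^ 2 := by
    obtain ⟨l, hl⟩ := Function.ne_iff.1 hz0
    exact Finset.sum_pos' (fun _ _ => by positivity)
      ⟨l, Finset.mem_univ _, by have := norm_pos_iff.2 hl; positivity⟩
  have hquad : ∑ l, d l * ‖z l‖ ^ 2 ≤ ∑ i, e i * ‖(M *ᵥ z) i‖ ^ 2 := by
    have h1 := h.dotProduct_mulVec_nonneg z
    rw [sub_mulVec, dotProduct_sub, ← mulVec_mulVec, ← mulVec_mulVec, dotProduct_mulVec,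
      ← star_mulVec, star_dotProduct_diagonal_mulVec, star_dotProduct_diagonal_mulVec,
      sub_nonneg] at h1
    exact_mod_cast h1
  have hlow : d j * ∑ l, ‖z l‖ ^ 2 ≤ ∑ l, d l * ‖z l‖ ^ 2 := by
    rw [Finset.mul_sum]
    refine Finset.sum_le_sum fun l _ => ?_
    rcases le_or_gt l j with hl | hl
    · exact mul_le_mul_of_nonneg_right (hd hl) (by positivity)
    · simp [hzj l hl]
  have hup : ∑ i, e i * ‖(M *ᵥ z) i‖ ^ 2 ≤ e ⟨j, hj⟩ * ∑ i, ‖(M *ᵥ z) i‖ ^ 2 := by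
    rw [Finset.mul_sum]
    refine Finset.sum_le_sum fun i _ => ?_
    rcases lt_or_ge i.val j.val with hi | hi
    · simp [hzero i hi]
    · exact mul_le_mul_of_nonneg_right (he (show (⟨j, hj⟩ : Fin n) ≤ i from hi)) (by positivity)
  rw [hnorm] at hup
  exact le_of_mul_le_mul_right (hlow.trans (hquad.trans hup)) hpos

/-- Cauchy interlacing: the ordered eigenvalues of a matrix dominated by the compression `Uᴴ B U`,
`U` an isometry, are dominated by those of `B`. -/
lemma eigenvalues₀_le_of_le_compression {κ : Type*} [Fintype κ] [DecidableEq κ]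
    {B : Matrix ι ι 𝕜} (hB : B.IsHermitian) {C : Matrix κ κ 𝕜} (hC : C.IsHermitian)
    {U : Matrix ι κ 𝕜} (hU : Uᴴ * U = 1) (h : (Uᴴ * B * U - C).PosSemidef)
    (j : Fin (Fintype.card κ)) (hj : j.val < Fintype.card ι) :
    hC.eigenvalues₀ j ≤ hB.eigenvalues₀ ⟨j, hj⟩ := by
  obtain ⟨V, hV, hV', hBV⟩ := exists_diagonal_eigenvalues₀ hB
  obtain ⟨T, hT, hT', hCT⟩ := exists_diagonal_eigenvalues₀ hC
  set D := diagonal (fun j => (hB.eigenvalues₀ j : 𝕜))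
  set E := diagonal (fun j => (hC.eigenvalues₀ j : 𝕜))
  refine le_of_diagonal_le_compression (𝕜 := 𝕜) (M := Vᴴ * U * T) hC.eigenvalues₀_antitone
    hB.eigenvalues₀_antitone ?_ ?_ j hj
  · calc (Vᴴ * U * T)ᴴ * (Vᴴ * U * T) = Tᴴ * (Uᴴ * (V * Vᴴ) * U) * T := by
          simp only [conjTranspose_mul, conjTranspose_conjTranspose, Matrix.mul_assoc]
      _ = 1 := by rw [hV', Matrix.mul_one, hU, Matrix.mul_one, hT]
  · have h1 := h.conjTranspose_mul_mul_same T
    have h2 : Tᴴ * (Uᴴ * B * U - C) * T = (Vᴴ * U * T)ᴴ * D * (Vᴴ * U * T) - E := by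
      have h3 : Tᴴ * C * T = E := by
        calc Tᴴ * C * T = (Tᴴ * T) * E * (Tᴴ * T) := by
              conv_lhs => rw [hCT]
              simp only [Matrix.mul_assoc]
          _ = E := by rw [hT, Matrix.one_mul, Matrix.mul_one]
      rw [Matrix.mul_sub, Matrix.sub_mul, h3]
      conv_lhs => rw [hBV]
      simp only [conjTranspose_mul, conjTranspose_conjTranspose, Matrix.mul_assoc]
    rwa [h2] at h1

lemma prod_filter_lt_eq_prod_castLE {n k : ℕ} (hk : k ≤ n) (f : Fin n → ℝ) :
    ∏ j : Fin n with j.val < k, f j = ∏ i : Fin k, f (Fin.castLE hk i) := by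
  symm
  refine Finset.prod_bij (fun i _ => Fin.castLE hk i) ?_ ?_ ?_ ?_
  · simp
  · intro a _ b _ h
    exact Fin.castLE_injective hk h
  · intro b hb
    exact ⟨⟨b, (Finset.mem_filter.1 hb).2⟩, Finset.mem_univ _, rfl⟩
  · simp

lemma PosSemidef.eigenvalues₀_nonneg {A : Matrix ι ι 𝕜} (hA : A.PosSemidef)
    (j : Fin (Fintype.card ι)) : 0 ≤ hA.isHermitian.eigenvalues₀ j := by
  have := hA.eigenvalues_nonneg (Fintype.equivOfCardEq (Fintype.card_fin _) j)
  simpa [IsHermitian.eigenvalues] using this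

lemma det_eq_prod_eigenvalues₀ {A : Matrix ι ι 𝕜} (hA : A.IsHermitian) :
    A.det = ((∏ j, hA.eigenvalues₀ j : ℝ) : 𝕜) := by
  rw [hA.det_eq_prod_eigenvalues, RCLike.ofReal_prod]
  exact Fintype.prod_equiv (Fintype.equivOfCardEq (Fintype.card_fin _)).symm _ _ fun i => rfl

/-- The determinant of a `k × k` positive semidefinite matrix dominated by a compression of `B` is
at most the product of the `k` largest eigenvalues of `B`. -/
lemma det_le_prod_eigenvalues₀_of_le_compression {k : ℕ} (hk : k ≤ Fintype.card ι)
    {B : Matrix ι ι 𝕜} (hB : B.PosSemidef) {C : Matrix (Fin k) (Fin k) 𝕜} (hC : C.PosSemidef)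
    {U : Matrix ι (Fin k) 𝕜} (hU : Uᴴ * U = 1) (h : (Uᴴ * B * U - C).PosSemidef) :
    C.det ≤ ((∏ i : Fin k, hB.isHermitian.eigenvalues₀ (Fin.castLE hk i) : ℝ) : 𝕜) := by
  rw [det_eq_prod_eigenvalues₀ hC.isHermitian, RCLike.ofReal_le_ofReal,
    ← Fintype.prod_equiv (finCongr (Fintype.card_fin k)) (fun j =>
      hB.isHermitian.eigenvalues₀ ⟨j, lt_of_lt_of_le (by simpa using j.2) hk⟩) _ fun _ => rfl]
  exact Finset.prod_le_prod (fun j _ => PosSemidef.eigenvalues₀_nonneg hC j) fun j _ =>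
    eigenvalues₀_le_of_le_compression hB.isHermitian hC.isHermitian hU h j _

end Eigenvalues

/-! ### From positive blocks to log-majorisation -/

section BlockMatrices

variable {ι 𝕜 : Type*} [Fintype ι] [DecidableEq ι] [RCLike 𝕜]

/-- If `x` is isotropic for `Q`, then `(0, x)` is isotropic for the whole semidefinite block, hence
in its kernel, which forces `D x = 0`. -/
lemma posDef_of_posSemidef_fromBlocks {P D Q : Matrix ι ι 𝕜} (hD : IsUnit D.det)
    (h : (fromBlocks P D Dᴴ Q).PosSemidef) : Q.PosDef := by
  have hQ : Q.PosSemidef := h.submatrix Sum.inr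
  refine .of_dotProduct_mulVec_pos hQ.isHermitian fun x hx => ?_
  refine lt_of_le_of_ne (hQ.dotProduct_mulVec_nonneg x) fun h0 => hx ?_
  have hv := (h.dotProduct_mulVec_zero_iff (Sum.elim 0 x)).1 (by
    simpa [fromBlocks_mulVec, dotProduct, Fintype.sum_sum_type] using h0.symm)
  have hDx : D *ᵥ x = 0 := by
    ext i
    simpa [fromBlocks_mulVec] using congrFun hv (Sum.inl i)
  calc x = (D⁻¹ * D) *ᵥ x := by rw [nonsing_inv_mul _ hD, one_mulVec]
    _ = 0 := by rw [← mulVec_mulVec, hDx, mulVec_zero]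

/-- If `[B, H; H, B]` is positive semidefinite and `H = W A` with `W` a Hermitian unitary, `A`
positive semidefinite, then `A` is weakly log-majorised by `B`. -/
theorem weakLogMajorized_of_posSemidef_fromBlocks {A B W : Matrix ι ι 𝕜} (hA : A.PosSemidef)
    (hB : B.PosSemidef) (hW : W * W = 1) (hWh : Wᴴ = W)
    (h : (fromBlocks B (W * A) (W * A)ᴴ B).PosSemidef) : WeakLogMajorized A B := by
  refine ⟨hA, hB, fun k hk => ?_⟩
  rw [prod_filter_lt_eq_prod_castLE hk, prod_filter_lt_eq_prod_castLE hk]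
  obtain ⟨V, hV, -, hAV⟩ := exists_diagonal_eigenvalues₀ hA.isHermitian
  set a : Fin k → ℝ := fun i => hA.isHermitian.eigenvalues₀ (Fin.castLE hk i) with ha
  set b : ℝ := ∏ i : Fin k, hB.isHermitian.eigenvalues₀ (Fin.castLE hk i) with hb
  have hb0 : 0 ≤ b := Finset.prod_nonneg fun i _ => PosSemidef.eigenvalues₀_nonneg hB _
  set U : Matrix ι (Fin k) 𝕜 := V.submatrix id (Fin.castLE hk) with hUdef
  have hUV : Uᴴ * V = (1 : Matrix _ _ 𝕜).submatrix (Fin.castLE hk) id := by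
    rw [← hV]; rfl
  have hU : Uᴴ * U = 1 := by
    have h1 : Uᴴ * U = (Vᴴ * V).submatrix (Fin.castLE hk) (Fin.castLE hk) := rfl
    rw [h1, hV, submatrix_one _ (Fin.castLE_injective hk)]
  set D : Matrix (Fin k) (Fin k) 𝕜 := diagonal fun i => (a i : 𝕜) with hD
  have hUAU : Uᴴ * A * U = D := by
    have h1 : Uᴴ * A * U = (Vᴴ * A * V).submatrix (Fin.castLE hk) (Fin.castLE hk) := rfl
    have h2 : Vᴴ * A * V = diagonal (fun j => (hA.isHermitian.eigenvalues₀ j : 𝕜)) := by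
      calc Vᴴ * A * V
          = (Vᴴ * V) * diagonal (fun j => (hA.isHermitian.eigenvalues₀ j : 𝕜)) * (Vᴴ * V) := by
            conv_lhs => rw [hAV]
            simp only [Matrix.mul_assoc]
        _ = _ := by rw [hV, Matrix.one_mul, Matrix.mul_one]
    rw [h1, h2, submatrix_diagonal _ _ (Fin.castLE_injective hk)]
    rfl
  have hDh : Dᴴ = D := by simp [hD, diagonal_conjTranspose, Pi.star_def]
  have hdet : D.det = ((∏ i, a i : ℝ) : 𝕜) := by simp [hD]
  have ha0 : ∀ i, 0 ≤ a i := fun i => PosSemidef.eigenvalues₀_nonneg hA _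
  have hWU : (W * U)ᴴ * (W * U) = 1 := by
    rw [conjTranspose_mul, hWh, Matrix.mul_assoc, ← Matrix.mul_assoc W W U, hW, Matrix.one_mul, hU]
  have hblock : (fromBlocks ((W * U)ᴴ * B * (W * U)) D Dᴴ (Uᴴ * B * U)).PosSemidef := by
    have h1 := h.conjTranspose_mul_mul_same (fromBlocks (W * U) 0 0 U)
    rw [fromBlocks_conjTranspose] at h1
    simp only [fromBlocks_multiply, conjTranspose_zero, Matrix.mul_zero, Matrix.zero_mul, add_zero,
      zero_add] at h1
    have h2 : (W * U)ᴴ * (W * A) * U = D := by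
      rw [conjTranspose_mul, hWh, ← hUAU, Matrix.mul_assoc Uᴴ W, ← Matrix.mul_assoc W W A, hW,
        Matrix.one_mul]
    have h3 : Uᴴ * (W * A)ᴴ * (W * U) = Dᴴ := by
      rw [← h2]
      simp only [conjTranspose_mul, conjTranspose_conjTranspose, Matrix.mul_assoc]
    rwa [h2, h3] at h1
  -- A vanishing product is trivial; otherwise `D` is invertible, so `Q` is too and the Schur
  -- complement is available.
  rcases (Finset.prod_nonneg fun i _ => ha0 i : 0 ≤ ∏ i, a i).eq_or_lt with h0 | hpos
  · rw [← h0]; exact hb0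
  have hDu : IsUnit D.det := by
    rw [hdet, isUnit_iff_ne_zero]
    exact_mod_cast hpos.ne'
  set Q := Uᴴ * B * U with hQ
  have hQd : Q.PosDef := posDef_of_posSemidef_fromBlocks hDu hblock
  have : Invertible Q := hQd.isUnit.invertible
  have hschur := (hQd.fromBlocks₂₂ _ D).1 hblock
  have hR : (D * Q⁻¹ * Dᴴ).PosSemidef := hQd.inv.posSemidef.mul_mul_conjTranspose_same D
  have h1 := det_le_prod_eigenvalues₀_of_le_compression hk hB hR hWU hschur
  have h2 := det_le_prod_eigenvalues₀_of_le_compression hk hB hQd.posSemidef hU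
    (by simpa [← hQ] using PosSemidef.zero)
  have h3 : (D * Q⁻¹ * Dᴴ).det * Q.det = (((∏ i, a i) ^ 2 : ℝ) : 𝕜) := by
    have hQ1 : Q⁻¹.det * Q.det = 1 := by
      rw [← det_mul, nonsing_inv_mul _ ((isUnit_iff_isUnit_det _).1 hQd.isUnit), det_one]
    rw [hDh, det_mul, det_mul]
    calc D.det * Q⁻¹.det * D.det * Q.det = D.det ^ 2 * (Q⁻¹.det * Q.det) := by ring
      _ = _ := by rw [hQ1, hdet]; push_cast; ring
  have h4 : (((∏ i, a i) ^ 2 : ℝ) : 𝕜) ≤ ((b ^ 2 : ℝ) : 𝕜) := by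
    rw [← h3]
    calc (D * Q⁻¹ * Dᴴ).det * Q.det ≤ (b : 𝕜) * (b : 𝕜) :=
          mul_le_mul h1 h2 hQd.det_pos.le (by exact_mod_cast hb0)
      _ = _ := by push_cast; ring
  rw [RCLike.ofReal_le_ofReal] at h4
  exact (sq_le_sq₀ hpos.le hb0).1 h4

end BlockMatrices

end SymModulus

theorem corollary6p2 {𝕜 : Type*} [RCLike 𝕜] (n m : ℕ)
    (X : Fin m → Matrix (Fin n) (Fin n) 𝕜)
    (hX : SymModulus.IsPolarHermitian (∑ k, X k)) :
    SymModulus.WeakLogMajorized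
      (SymModulus.symModulus (∑ k, X k)) (∑ k, SymModulus.symModulus (X k)) := by
  obtain ⟨c, hc, W, hW, hWh, hS⟩ := hX.exists_unit
  have h := SymModulus.posSemidef_fromBlocks_sum_symModulus Finset.univ hc X
  rw [SymModulus.rotatedRealPart_eq_mul_symModulus hc hW hWh hS] at h
  -- Hermitian symmetry of the block makes `W A` self-adjoint.
  have hH := (isHermitian_fromBlocks_iff.1 h.isHermitian).2.1
  refine SymModulus.weakLogMajorized_of_posSemidef_fromBlocks (SymModulus.symModulus_posSemidef _)
    (posSemidef_sum _ fun k _ => SymModulus.symModulus_posSemidef _) hW hWh ?_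
  rwa [hH]
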